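/- Let $n\ge 0$. For a permutation $\pi$ of $\{1,\dots,n\}$ let $D(\pi)=\sum_{i=1}^n|i-\pi(i)|$ be its total displacement, and for $d\ge 0$ let $D(n,d)$ be the number of permutations $\pi$ of $\{1,\dots,n\}$ with $D(\pi)=2d$. A Motzkin path of width $n$ is a sequence of $n$ moves, each up-right ($U$), horizontal-right ($H$) or down-right ($D$), that starts at $(0,0)$, never goes below height $0$ and ends at height $0$; its area is the area between the path and the horizontal axis. Let $\mathit{MZ}(n,A)$ be the set of Motzkin paths of width $n$ and area $A$. The weight of a Motzkin path $\mathit{mz}$ is $\omega(\mathit{mz})=\prod_{i=1}^n\omega_i$, where, with $h_i$ the maximum height of the path during move $i$, $\omega_i=h_i$ if move $i$ is $U$ or $D$ and $\omega_i=2h_i+1$ if move $i$ is $H$. The path of a permutation $\pi$ has as its $i$-th move $U$ if $\pi(i)>i<\pi^{-1}(i)$, $D$ if $\pi(i)<i>\pi^{-1}(i)$, and $H$ otherwise. A building sequence of width $n$ and area $A$ ($A\ge 0$) is a finite sequence $a=(f_0,p_1,f_1,p_2,\dots,p_h,f_h)$ of non-negative integers, $h\ge 0$, with $p_1,\dots,p_h>0$,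 $\sum_{i=0}^h f_i+2\sum_{i=1}^h p_i=n$ and $\sum_{i=0}^h i f_i+\sum_{i=1}^h(2i-1)p_i=A$. Let $S(n,A)$ be the set of these sequences. For such $a$ put, with $p_{h+1}:=0$, $$m(a)=\prod_{i=1}^{h}\binom{p_{i+1}+f_i+p_i-1}{p_i-1}\binom{p_i+f_{i-1}}{f_{i-1}},\qquad \mathit{perm}(a)=\prod_{i=0}^h(2i+1)^{f_i}\prod_{i=1}^h i^{2p_i},\qquad P(a)=m(a)\cdot\mathit{perm}(a).$$ There is a surjective mapping from the permutations of $\{1,\dots,n\}$ onto the building sequences of width $n$ (of any area) such that, for every $A\ge 0$ and every $a\in S(n,A)$, the number of permutations $\pi$ with $D(\pi)=2A$ that are mapped to $a$ is exactly $P(a)$. Namely, $\pi$ is mapped to the building sequence in which $f_i$ is the number of moves $H$ at height $i$, and $p_i$ the number of moves $U$ from height $i-1$ to height $i$ (equivalently, of moves $D$ from height $i$ to height $i-1$), of the path of $\pi$, which is a Motzkin path. Consequently, for every $A\ge 0$, $$D(n,A)=\sum_{\mathit{mz}\in \mathit{MZ}(n,A)}\omega(\mathit{mz})=\sum_{a\in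 S(n,A)}P(a).$$ -/

import Mathlib

/-- The total displacement `∑ |i - π(i)|` of a permutation of `n` elements. -/
def totalDisplacement {n : ℕ} (π : Equiv.Perm (Fin n)) : ℕ :=
  ∑ i : Fin n, ((i.val : ℤ) - ((π i).val : ℤ)).natAbs

/-- `D(n, d)`: the number of permutations of `n` elements of total displacement `2d`. -/
def displacementNumber (n d : ℕ) : ℕ :=
  (Finset.univ.filter fun π : Equiv.Perm (Fin n) => totalDisplacement π = 2 * d).card

/-- The three moves of a lattice path: up-right, horizontal-right, down-right. -/
inductive Move where
  | U | H | D
  deriving DecidableEq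

instance : Fintype Move where
  elems := {Move.U, Move.H, Move.D}
  complete := fun x => by cases x <;> decide

/-- The change of height caused by a move. -/
def Move.rise : Move → ℤ
  | .U => 1
  | .H => 0
  | .D => -1

/-- The height, after the first `k` moves, of the path that starts at `(0, 0)` and follows `w`. -/
def pathHeight {n : ℕ} (w : Fin n → Move) (k : ℕ) : ℤ :=
  ∑ i : Fin n, if i.val < k then (w i).rise else 0

/-- `w` is a Motzkin path: it never goes below height `0` and ends at height `0`. -/
def IsMotzkin {n : ℕ} (w : Fin n → Move) : Prop :=
  (∀ k ≤ n, 0 ≤ pathHeight w k) ∧ pathHeight w n = 0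

/-- The area between the path and the horizontal axis; each move contributes a trapezoid of
width one. -/
def pathArea {n : ℕ} (w : Fin n → Move) : ℚ :=
  ∑ i : Fin n, ((pathHeight w i.val : ℚ) + (pathHeight w (i.val + 1) : ℚ)) / 2

/-- The maximum height of the path during its move `i`. -/
def moveHeight {n : ℕ} (w : Fin n → Move) (i : Fin n) : ℤ :=
  max (pathHeight w i.val) (pathHeight w (i.val + 1))

/-- The weight `ω` of a path: the product of `h_i` over the moves `U`, `D` and of `2 h_i + 1` over
the moves `H`, where `h_i` is the maximum height during move `i`. -/
def pathWeight {n : ℕ} (w : Fin n → Move) : ℤ :=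
  ∏ i : Fin n, if w i = Move.H then 2 * moveHeight w i + 1 else moveHeight w i

open Classical in
/-- The set of all Motzkin paths of width `n` and area `A`. -/
noncomputable def motzkinPaths (n A : ℕ) : Finset (Fin n → Move) :=
  Finset.univ.filter fun w => IsMotzkin w ∧ pathArea w = (A : ℚ)

/-- The path of a permutation: move `i` is `U` if `π(i) > i < π⁻¹(i)`, it is `D` if
`π(i) < i > π⁻¹(i)`, and it is `H` otherwise. -/
def permPath {n : ℕ} (π : Equiv.Perm (Fin n)) : Fin n → Move := fun i =>
  if i < π i ∧ i < π.symm i then Move.U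
  else if π i < i ∧ π.symm i < i then Move.D
  else Move.H

/-- A sequence `(f_0, p_1, f_1, p_2, …, p_h, f_h)` of natural numbers with all `p_i` non-zero. The
entries are `f i` for `i ≤ h` and `p i` for `1 ≤ i ≤ h`; values at other indices are set to `0`, so
that two sequences are equal exactly if they have the same length and the same entries. -/
@[ext]
structure BuildingSequence where
  h : ℕ
  f : ℕ → ℕ
  p : ℕ → ℕ
  p_pos : ∀ i, 1 ≤ i → i ≤ h → 0 < p i
  p_zero : p 0 = 0
  p_eq_zero : ∀ i, h < i → p i = 0
  f_eq_zero : ∀ i, h < i → f i = 0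

namespace BuildingSequence

/-- The width `(f_0 + ⋯ + f_h) + 2 (p_1 + ⋯ + p_h)`. -/
def width (a : BuildingSequence) : ℕ :=
  ∑ i ∈ Finset.range (a.h + 1), a.f i + 2 * ∑ i ∈ Finset.Icc 1 a.h, a.p i

/-- The area `(0 f_0 + 1 f_1 + ⋯ + h f_h) + (1 p_1 + 3 p_2 + ⋯ + (2h-1) p_h)`. -/
def area (a : BuildingSequence) : ℕ :=
  ∑ i ∈ Finset.range (a.h + 1), i * a.f i + ∑ i ∈ Finset.Icc 1 a.h, (2 * i - 1) * a.p i

/-- `m(a)`, the product over `i = h, h-1, …, 1` of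
`C(p_{i+1} + f_i + p_i - 1, p_i - 1) * C(p_i + f_{i-1}, f_{i-1})`, with `p_{h+1} = 0`. -/
def m (a : BuildingSequence) : ℕ :=
  ∏ i ∈ Finset.Icc 1 a.h,
    (a.p (i + 1) + a.f i + a.p i - 1).choose (a.p i - 1) *
      (a.p i + a.f (i - 1)).choose (a.f (i - 1))

/-- `perm(a)`, the product of all `(2i+1)^{f_i}` and all `i^{2 p_i}`. -/
def perm (a : BuildingSequence) : ℕ :=
  (∏ i ∈ Finset.range (a.h + 1), (2 * i + 1) ^ a.f i) *
    ∏ i ∈ Finset.Icc 1 a.h, i ^ (2 * a.p i)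

/-- `P(a) = m(a) * perm(a)`. -/
def P (a : BuildingSequence) : ℕ := a.m * a.perm

theorem f_le_width (a : BuildingSequence) (i : ℕ) : a.f i ≤ a.width := by
  by_cases hi : i ≤ a.h
  · have h1 : a.f i ≤ ∑ j ∈ Finset.range (a.h + 1), a.f j :=
      Finset.single_le_sum (f := a.f) (fun _ _ => Nat.zero_le _)
        (Finset.mem_range.2 (by omega))
    unfold width
    omega
  · rw [a.f_eq_zero i (by omega)]
    exact Nat.zero_le _

theorem p_le_width (a : BuildingSequence) (i : ℕ) : a.p i ≤ a.width := by
  by_cases hi : 1 ≤ i ∧ i ≤ a.h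
  · have h1 : a.p i ≤ ∑ j ∈ Finset.Icc 1 a.h, a.p j :=
      Finset.single_le_sum (f := a.p) (fun _ _ => Nat.zero_le _) (Finset.mem_Icc.2 hi)
    unfold width
    omega
  · have : a.p i = 0 := by
      rcases Nat.eq_zero_or_pos i with h0 | h0
      · rw [h0, a.p_zero]
      · exact a.p_eq_zero i (by omega)
    omega

theorem h_le_width (a : BuildingSequence) : a.h ≤ a.width := by
  have h1 : ∑ _j ∈ Finset.Icc 1 a.h, 1 ≤ ∑ j ∈ Finset.Icc 1 a.h, a.p j :=
    Finset.sum_le_sum fun j hj => a.p_pos j (Finset.mem_Icc.1 hj).1 (Finset.mem_Icc.1 hj).2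
  simp only [Finset.sum_const, Nat.card_Icc, smul_eq_mul, mul_one] at h1
  unfold width
  omega

theorem finite_width_eq (n : ℕ) : {a : BuildingSequence | a.width = n}.Finite := by
  let F : BuildingSequence →
      Fin (n + 1) × (Fin (n + 1) → Fin (n + 1)) × (Fin (n + 1) → Fin (n + 1)) := fun a =>
    (Fin.ofNat (n + 1) a.h, fun i => Fin.ofNat (n + 1) (a.f i), fun i => Fin.ofNat (n + 1) (a.p i))
  refine Set.Finite.of_injOn (f := F) (t := Set.univ) (fun _ _ => Set.mem_univ _) ?_
    Set.finite_univ
  intro a ha b hb hab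
  have key : ∀ x y : ℕ, x ≤ n → y ≤ n → Fin.ofNat (n + 1) x = Fin.ofNat (n + 1) y → x = y := by
    intro x y hx hy hxy
    have h2 := congrArg Fin.val hxy
    simp only [Fin.ofNat] at h2
    rwa [Nat.mod_eq_of_lt (by omega), Nat.mod_eq_of_lt (by omega)] at h2
  simp only [Set.mem_ofPred_eq] at ha hb
  simp only [F, Prod.mk.injEq] at hab
  obtain ⟨h1, h2, h3⟩ := hab
  have hah := a.h_le_width
  have hbh := b.h_le_width
  refine BuildingSequence.ext (key _ _ (by omega) (by omega) h1) (funext fun i => ?_)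
    (funext fun i => ?_)
  · by_cases hi : i ≤ n
    · have haf := a.f_le_width i
      have hbf := b.f_le_width i
      exact key _ _ (by omega) (by omega) (congrFun h2 ⟨i, by omega⟩)
    · rw [a.f_eq_zero i (by omega), b.f_eq_zero i (by omega)]
  · by_cases hi : i ≤ n
    · have haf := a.p_le_width i
      have hbf := b.p_le_width i
      exact key _ _ (by omega) (by omega) (congrFun h3 ⟨i, by omega⟩)
    · rw [a.p_eq_zero i (by omega), b.p_eq_zero i (by omega)]

end BuildingSequence

theorem finite_width_area (n A : ℕ) :
    {a : BuildingSequence | a.width = n ∧ a.area = A}.Finite :=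
  (BuildingSequence.finite_width_eq n).subset fun _ ha => ha.1

/-- `S(n, A)`: the finite set of all building sequences of width `n` and area `A`. -/
noncomputable def buildingSequences (n A : ℕ) : Finset BuildingSequence :=
  (finite_width_area n A).toFinset

theorem mem_buildingSequences {n A : ℕ} {a : BuildingSequence} :
    a ∈ buildingSequences n A ↔ a.width = n ∧ a.area = A := by
  simp [buildingSequences]

/-- `w` is a Motzkin path that arises by splitting and rearranging the blocks of `a`: its moves are
`f_i` flats at height `i` and, from `p_i` peaks of height `i`, `p_i` up-moves from height `i - 1`
to `i` and `p_i` down-moves from height `i` to `i - 1`, for every `i`. -/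
def IsBuiltFrom {n : ℕ} (w : Fin n → Move) (a : BuildingSequence) : Prop :=
  IsMotzkin w ∧ ∀ i : ℕ,
    (Finset.univ.filter fun j => w j = Move.H ∧ moveHeight w j = i).card = a.f i ∧
    (Finset.univ.filter fun j => w j = Move.U ∧ moveHeight w j = i).card = a.p i ∧
    (Finset.univ.filter fun j => w j = Move.D ∧ moveHeight w j = i).card = a.p i

section Paths

variable {n : ℕ}

theorem pathHeight_zero (w : Fin n → Move) : pathHeight w 0 = 0 := by
  simp [pathHeight]

theorem pathHeight_succ (w : Fin n → Move) (i : Fin n) :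
    pathHeight w (i.val + 1) = pathHeight w i.val + (w i).rise := by
  unfold pathHeight
  have h : ∀ j : Fin n, (if j.val < i.val + 1 then (w j).rise else 0) =
      (if j.val < i.val then (w j).rise else 0) + if j = i then (w j).rise else 0 := by
    intro j
    rcases lt_trichotomy j.val i.val with h | h | h
    · rw [if_pos (by omega), if_pos h, if_neg (by rintro rfl; omega), add_zero]
    · have : j = i := Fin.ext h
      simp [this]
    · rw [if_neg (by omega), if_neg (by omega), if_neg (by rintro rfl; omega), add_zero]
  rw [Finset.sum_congr rfl fun j _ => h j, Finset.sum_add_distrib]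
  simp

theorem moveHeight_eq (w : Fin n → Move) (i : Fin n) :
    moveHeight w i = pathHeight w i.val + if w i = Move.U then 1 else 0 := by
  unfold moveHeight
  rw [pathHeight_succ]
  cases w i <;> simp [Move.rise]

theorem pathHeight_snoc (w : Fin n → Move) (m : Move) {k : ℕ} (hk : k ≤ n) :
    pathHeight (Fin.snoc w m : Fin (n + 1) → Move) k = pathHeight w k := by
  unfold pathHeight
  rw [Fin.sum_univ_castSucc]
  simp [show ¬ n < k by omega]

theorem pathHeight_snoc_last (w : Fin n → Move) (m : Move) :
    pathHeight (Fin.snoc w m : Fin (n + 1) → Move) (n + 1) = pathHeight w n + m.rise := by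
  have h := pathHeight_succ (Fin.snoc w m : Fin (n + 1) → Move) (Fin.last n)
  simp only [Fin.val_last, Fin.snoc_last] at h
  rw [h, pathHeight_snoc w m le_rfl]

theorem moveHeight_snoc_castSucc (w : Fin n → Move) (m : Move) (i : Fin n) :
    moveHeight (Fin.snoc w m : Fin (n + 1) → Move) i.castSucc = moveHeight w i := by
  rw [moveHeight_eq, moveHeight_eq, Fin.snoc_castSucc, Fin.val_castSucc,
    pathHeight_snoc w m i.isLt.le]

theorem moveHeight_snoc_last (w : Fin n → Move) (m : Move) :
    moveHeight (Fin.snoc w m : Fin (n + 1) → Move) (Fin.last n) =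
      pathHeight w n + if m = Move.U then 1 else 0 := by
  rw [moveHeight_eq, Fin.snoc_last, Fin.val_last, pathHeight_snoc w m le_rfl]

/-- The path never goes below height `0`. -/
def StaysNonneg (w : Fin n → Move) : Prop := ∀ k ≤ n, 0 ≤ pathHeight w k

theorem staysNonneg_snoc (w : Fin n → Move) (m : Move) :
    StaysNonneg (Fin.snoc w m : Fin (n + 1) → Move) ↔
      StaysNonneg w ∧ 0 ≤ pathHeight w n + m.rise := by
  constructor
  · intro h
    refine ⟨fun k hk => ?_, ?_⟩
    · have := h k (by omega)
      rwa [pathHeight_snoc w m hk] at this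
    · have := h (n + 1) le_rfl
      rwa [pathHeight_snoc_last] at this
  · rintro ⟨h1, h2⟩ k hk
    rcases Nat.lt_or_ge n k with h | h
    · obtain rfl : k = n + 1 := by omega
      rwa [pathHeight_snoc_last]
    · rw [pathHeight_snoc w m h]
      exact h1 k h

/-- The number of moves `m` of maximum height `i`. -/
def moveCount (w : Fin n → Move) (m : Move) (i : ℕ) : ℕ :=
  (Finset.univ.filter fun j => w j = m ∧ moveHeight w j = i).card

theorem moveCount_snoc (w : Fin n → Move) (m m' : Move) (i : ℕ) :
    moveCount (Fin.snoc w m : Fin (n + 1) → Move) m' i = moveCount w m' i +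
      if m = m' ∧ pathHeight w n + (if m = Move.U then 1 else 0) = (i : ℤ) then 1 else 0 := by
  unfold moveCount
  rw [Finset.card_filter, Finset.card_filter, Fin.sum_univ_castSucc]
  simp only [Fin.snoc_castSucc, Fin.snoc_last, moveHeight_snoc_castSucc, moveHeight_snoc_last]

theorem moveCount_U_eq (w : Fin n → Move) (hw : StaysNonneg w) (i : ℕ) (hi : 1 ≤ i) :
    moveCount w Move.U i =
      moveCount w Move.D i + if (i : ℤ) ≤ pathHeight w n then 1 else 0 := by
  induction n with
  | zero => simp [moveCount, pathHeight]; omega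
  | succ n ih =>
    obtain ⟨v, m, rfl⟩ : ∃ (v : Fin n → Move) (m : Move), w = Fin.snoc v m :=
      ⟨Fin.init w, w (Fin.last n), (Fin.snoc_init_self w).symm⟩
    obtain ⟨h1, h2⟩ := (staysNonneg_snoc v m).1 hw
    rw [moveCount_snoc, moveCount_snoc, pathHeight_snoc_last, ih v h1]
    cases m <;> simp only [Move.rise, reduceCtorEq, true_and, false_and, if_true, if_false,
      add_zero] at h2 ⊢ <;> grind

theorem moveCount_UD_zero (w : Fin n → Move) (hw : StaysNonneg w) :
    moveCount w Move.U 0 = 0 ∧ moveCount w Move.D 0 = 0 := by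
  unfold moveCount
  constructor <;> rw [Finset.card_eq_zero, Finset.filter_eq_empty_iff] <;> rintro j - ⟨h1, h2⟩
  · rw [moveHeight_eq, if_pos h1] at h2
    have := hw j.val j.isLt.le
    push_cast at h2
    omega
  · have h3 := pathHeight_succ w j
    rw [moveHeight_eq, h1] at h2
    rw [h1] at h3
    have := hw (j.val + 1) j.isLt
    simp [Move.rise] at h2 h3
    omega

/-- A path that reaches a height `i ≥ 1` has an up-move to height `i`. -/
theorem exists_up_of_le_pathHeight (w : Fin n → Move) {i : ℕ} (hi : 1 ≤ i) (k : ℕ) (hk : k ≤ n)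
    (h : (i : ℤ) ≤ pathHeight w k) : ∃ j, w j = Move.U ∧ moveHeight w j = i := by
  induction k with
  | zero => rw [pathHeight_zero] at h; omega
  | succ k ih =>
    by_cases h' : (i : ℤ) ≤ pathHeight w k
    · exact ih (by omega) h'
    · have h1 := pathHeight_succ w ⟨k, hk⟩
      have h2 := moveHeight_eq w ⟨k, hk⟩
      refine ⟨⟨k, hk⟩, ?_⟩
      cases hm : w ⟨k, hk⟩ <;> simp [hm, Move.rise] at h1 h2 ⊢ <;> omega

theorem moveCount_U_pos (w : Fin n → Move) {i : ℕ} (hi : 1 ≤ i) (j : Fin n)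
    (h : (i : ℤ) ≤ moveHeight w j) : 0 < moveCount w Move.U i := by
  obtain ⟨l, hl⟩ : ∃ l, w l = Move.U ∧ moveHeight w l = i := by
    rcases le_max_iff.1 h with h | h
    · exact exists_up_of_le_pathHeight w hi _ j.isLt.le h
    · exact exists_up_of_le_pathHeight w hi _ j.isLt h
  exact Finset.card_pos.2 ⟨l, by simp [hl]⟩

theorem moveHeight_nonneg (w : Fin n → Move) (hw : StaysNonneg w) (j : Fin n) :
    0 ≤ moveHeight w j :=
  le_max_of_le_left (hw _ j.isLt.le)

end Paths

/-- The number of maximal pieces above height `i` of a path to height `j` that has `d i`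
down-moves from height `i`. -/
def pieceCount (j : ℕ) (d : ℕ → ℕ) (i : ℕ) : ℕ :=
  if i = 0 then 1 else d i + if i ≤ j then 1 else 0

/-- The number of ways to arrange the flats and excursions at height `i`. -/
def levelFactor (j : ℕ) (f d : ℕ → ℕ) (i : ℕ) : ℕ :=
  (pieceCount j d i).multichoose (d (i + 1) + f i) * (d (i + 1) + f i).choose (f i)

open Classical in
/-- The paths to height `j` that never go below `0`, with `f i` flats at height `i` and `d i`
down-moves from height `i`. -/
noncomputable def pathsWithCounts (n j : ℕ) (f d : ℕ → ℕ) : Finset (Fin n → Move) :=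
  Finset.univ.filter fun w => StaysNonneg w ∧ pathHeight w n = j ∧
    ∀ i, moveCount w Move.H i = f i ∧ moveCount w Move.D i = d i

theorem Move.univ_eq : (Finset.univ : Finset Move) = {Move.U, Move.H, Move.D} := rfl

theorem card_filter_snoc {n : ℕ} (p : (Fin (n + 1) → Move) → Prop) [DecidablePred p] :
    (Finset.univ.filter p).card =
      ∑ m : Move, (Finset.univ.filter fun w : Fin n → Move => p (Fin.snoc w m)).card := by
  simp only [Finset.card_filter]
  rw [← (Fin.snocEquiv fun _ : Fin (n + 1) => Move).sum_comp, Fintype.sum_prod_type]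
  rfl

theorem card_pathsWithCounts_succ (n j : ℕ) (f d : ℕ → ℕ) :
    (pathsWithCounts (n + 1) j f d).card =
      (if 0 < j then (pathsWithCounts n (j - 1) f d).card else 0) +
      (if 0 < f j then
        (pathsWithCounts n j (Function.update f j (f j - 1)) d).card else 0) +
      (if 0 < d (j + 1) then
        (pathsWithCounts n (j + 1) f (Function.update d (j + 1) (d (j + 1) - 1))).card else 0) := by
  classical
  unfold pathsWithCounts
  rw [card_filter_snoc, Move.univ_eq, Finset.sum_insert (by decide),
    Finset.sum_insert (by decide), Finset.sum_singleton, ← add_assoc]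
  simp only [staysNonneg_snoc, pathHeight_snoc_last, moveCount_snoc, Move.rise, reduceCtorEq,
    if_true, if_false, false_and, true_and, add_zero]
  congr 1
  · congr 1
    · split_ifs with hj
      · congr 1
        ext w
        simp only [Finset.mem_filter_univ]
        constructor
        · rintro ⟨⟨h1, h2⟩, h3, h4⟩
          exact ⟨h1, by omega, h4⟩
        · rintro ⟨h1, h2, h3⟩
          exact ⟨⟨h1, by omega⟩, by omega, h3⟩
      · rw [Finset.card_eq_zero, Finset.filter_eq_empty_iff]
        rintro w - ⟨⟨h1, h2⟩, h3, h4⟩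
        have := h1 n le_rfl
        omega
    · split_ifs with hj
      · congr 1
        ext w
        simp only [Finset.mem_filter_univ]
        constructor
        · rintro ⟨⟨h1, h2⟩, h3, h4⟩
          refine ⟨h1, h3, fun i => ⟨?_, (h4 i).2⟩⟩
          have := (h4 i).1
          by_cases hij : i = j
          · subst hij
            rw [if_pos h3] at this
            rw [Function.update_self]
            omega
          · rw [if_neg (by omega)] at this
            rw [Function.update_of_ne hij]
            omega
        · rintro ⟨h1, h2, h3⟩
          refine ⟨⟨h1, by omega⟩, h2, fun i => ⟨?_, (h3 i).2⟩⟩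
          have := (h3 i).1
          by_cases hij : i = j
          · subst hij
            rw [Function.update_self] at this
            rw [if_pos h2]
            omega
          · rw [Function.update_of_ne hij] at this
            rw [if_neg (by omega)]
            omega
      · rw [Finset.card_eq_zero, Finset.filter_eq_empty_iff]
        rintro w - ⟨⟨h1, h2⟩, h3, h4⟩
        have := (h4 j).1
        rw [if_pos h3] at this
        omega
  · split_ifs with hj
    · congr 1
      ext w
      simp only [Finset.mem_filter_univ]
      constructor
      · rintro ⟨⟨h1, h2⟩, h3, h4⟩
        refine ⟨h1, by omega, fun i => ⟨(h4 i).1, ?_⟩⟩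
        have := (h4 i).2
        by_cases hij : i = j + 1
        · subst hij
          rw [if_pos (by omega)] at this
          rw [Function.update_self]
          omega
        · rw [if_neg (by omega)] at this
          rw [Function.update_of_ne hij]
          omega
      · rintro ⟨h1, h2, h3⟩
        refine ⟨⟨h1, by omega⟩, by omega, fun i => ⟨(h3 i).1, ?_⟩⟩
        have := (h3 i).2
        by_cases hij : i = j + 1
        · subst hij
          rw [Function.update_self] at this
          rw [if_pos (by omega)]
          omega
        · rw [Function.update_of_ne hij] at this
          rw [if_neg (by omega)]
          omega
    · rw [Finset.card_eq_zero, Finset.filter_eq_empty_iff]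
      rintro w - ⟨⟨h1, h2⟩, h3, h4⟩
      have := (h4 (j + 1)).2
      rw [if_pos (by omega)] at this
      omega

theorem levelFactor_recurrence (P u f : ℕ) (hP : 0 < P) (hk : 0 < u + f) :
    P.multichoose (u + f) * (u + f).choose f =
      (P - 1).multichoose (u + f) * (u + f).choose f +
      (if 0 < f then P.multichoose (u + (f - 1)) * (u + (f - 1)).choose (f - 1) else 0) +
      (if 0 < u then P.multichoose (u - 1 + f) * (u - 1 + f).choose f else 0) := by
  obtain ⟨P, rfl⟩ := Nat.exists_eq_succ_of_ne_zero hP.ne'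
  rcases f with _ | f
  · obtain ⟨u, rfl⟩ := Nat.exists_eq_succ_of_ne_zero (show u ≠ 0 by omega)
    simp [Nat.multichoose_succ_succ]
  · rcases u with _ | u
    · simp [Nat.multichoose_succ_succ]
    · simp only [Nat.succ_eq_add_one, Nat.add_sub_cancel, Nat.zero_lt_succ, if_true]
      have e1 : u + 1 + (f + 1) = (u + 1 + f) + 1 := by ring
      have e2 : u + (f + 1) = u + 1 + f := by ring
      rw [e1, e2, Nat.multichoose_succ_succ, Nat.choose_succ_succ]
      ring

theorem prod_range_eq_mul_prod_erase {N j : ℕ} (hj : j < N) (g : ℕ → ℕ) :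
    ∏ i ∈ Finset.range N, g i = g j * ∏ i ∈ (Finset.range N).erase j, g i :=
  (Finset.mul_prod_erase _ _ (Finset.mem_range.2 hj)).symm

theorem card_pathsWithCounts (N n j : ℕ) (f d : ℕ → ℕ) (hj : j < N) (hf : ∀ i, N ≤ i → f i = 0)
    (hd : ∀ i, N ≤ i → d i = 0) (hd0 : d 0 = 0)
    (hn : ∑ i ∈ Finset.range N, f i + 2 * ∑ i ∈ Finset.range N, d i + j = n) :
    (pathsWithCounts n j f d).card = ∏ i ∈ Finset.range N, levelFactor j f d i := by
  induction n generalizing j f d with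
  | zero =>
    obtain rfl : j = 0 := by omega
    have hf' : ∀ i, f i = 0 := by
      intro i
      rcases Nat.lt_or_ge i N with h | h
      · have h0 : ∑ i ∈ Finset.range N, f i = 0 := by omega
        exact Finset.sum_eq_zero_iff.1 h0 i (Finset.mem_range.2 h)
      · exact hf i h
    have hd' : ∀ i, d i = 0 := by
      intro i
      rcases Nat.lt_or_ge i N with h | h
      · have h0 : ∑ i ∈ Finset.range N, d i = 0 := by omega
        exact Finset.sum_eq_zero_iff.1 h0 i (Finset.mem_range.2 h)
      · exact hd i h
    rw [Finset.prod_eq_one fun i _ => by simp [levelFactor, hf', hd', Nat.multichoose_zero_right]]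
    classical
    unfold pathsWithCounts
    rw [Finset.filter_true_of_mem, Finset.card_univ]
    · simp
    · rintro w -
      refine ⟨fun k hk => ?_, ?_, fun i => ?_⟩
      · simp [pathHeight]
      · simp [pathHeight]
      · simp [moveCount, hf', hd']
  | succ n ih =>
    have hU : (if 0 < j then (pathsWithCounts n (j - 1) f d).card else 0) =
        if 0 < j then ∏ i ∈ Finset.range N, levelFactor (j - 1) f d i else 0 := by
      split_ifs with h
      · exact ih (j - 1) f d (by omega) hf hd hd0 (by omega)
      · rfl
    have hH : (if 0 < f j then
        (pathsWithCounts n j (Function.update f j (f j - 1)) d).card else 0) =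
        if 0 < f j then
          ∏ i ∈ Finset.range N, levelFactor j (Function.update f j (f j - 1)) d i else 0 := by
      split_ifs with h
      · refine ih j _ d hj (fun i hi => ?_) hd hd0 ?_
        · rw [Function.update_of_ne (by omega), hf i hi]
        · rw [Finset.sum_update_of_mem (Finset.mem_range.2 hj)]
          rw [Finset.sum_eq_add_sum_sdiff_singleton_of_mem (Finset.mem_range.2 hj) f] at hn
          omega
      · rfl
    have hD : (if 0 < d (j + 1) then
        (pathsWithCounts n (j + 1) f (Function.update d (j + 1) (d (j + 1) - 1))).card else 0) =
        if 0 < d (j + 1) then ∏ i ∈ Finset.range N,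
          levelFactor (j + 1) f (Function.update d (j + 1) (d (j + 1) - 1)) i else 0 := by
      split_ifs with h
      · have hj' : j + 1 < N := by
          by_contra hc
          rw [hd _ (by omega)] at h
          omega
        refine ih (j + 1) f _ hj' hf (fun i hi => ?_) ?_ ?_
        · rw [Function.update_of_ne (by omega), hd i hi]
        · rw [Function.update_of_ne (by omega), hd0]
        · rw [Finset.sum_update_of_mem (Finset.mem_range.2 hj')]
          rw [Finset.sum_eq_add_sum_sdiff_singleton_of_mem (Finset.mem_range.2 hj') d] at hn
          omega
      · rfl
    rw [card_pathsWithCounts_succ, hU, hH, hD]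
    clear hU hH hD ih
    by_cases hk : 0 < d (j + 1) + f j
    · simp only [prod_range_eq_mul_prod_erase hj]
      set R := ∏ i ∈ (Finset.range N).erase j, levelFactor j f d i with hR
      have r1 : 0 < j → ∏ i ∈ (Finset.range N).erase j, levelFactor (j - 1) f d i = R := by
        intro h
        refine Finset.prod_congr rfl fun i hi => ?_
        have hij := Finset.ne_of_mem_erase hi
        have : pieceCount (j - 1) d i = pieceCount j d i := by
          unfold pieceCount
          split_ifs <;> omega
        simp only [levelFactor, this]
      have r2 : ∏ i ∈ (Finset.range N).erase j,
          levelFactor j (Function.update f j (f j - 1)) d i = R := by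
        refine Finset.prod_congr rfl fun i hi => ?_
        have hij := Finset.ne_of_mem_erase hi
        simp only [levelFactor, Function.update_of_ne hij]
      have r3 : 0 < d (j + 1) → ∏ i ∈ (Finset.range N).erase j,
          levelFactor (j + 1) f (Function.update d (j + 1) (d (j + 1) - 1)) i = R := by
        intro h
        refine Finset.prod_congr rfl fun i hi => ?_
        have hij := Finset.ne_of_mem_erase hi
        have : pieceCount (j + 1) (Function.update d (j + 1) (d (j + 1) - 1)) i =
            pieceCount j d i := by
          unfold pieceCount
          by_cases hij' : i = j + 1
          · subst hij'
            simp
            omega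
          · rw [Function.update_of_ne hij']
            split_ifs <;> omega
        simp only [levelFactor, this]
        rw [Function.update_of_ne (by omega)]
      have hP : 0 < pieceCount j d j := by
        unfold pieceCount
        split_ifs <;> omega
      have key := levelFactor_recurrence (pieceCount j d j) (d (j + 1)) (f j) hP hk
      have l0 : levelFactor j f d j =
        (pieceCount j d j).multichoose (d (j + 1) + f j) * (d (j + 1) + f j).choose (f j) := rfl
      rw [l0, key, add_mul, add_mul]
      congr 1
      · congr 1
        · split_ifs with h
          · rw [r1 h, levelFactor]
            congr 3
            unfold pieceCount
            split_ifs <;> omega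
          · obtain rfl : j = 0 := by omega
            obtain ⟨k, hk'⟩ := Nat.exists_eq_succ_of_ne_zero hk.ne'
            rw [hk']
            simp [pieceCount, Nat.multichoose_zero_succ]
        · split_ifs with h
          · rw [r2, levelFactor, Function.update_self]
          · simp
      · split_ifs with h
        · have : pieceCount (j + 1) (Function.update d (j + 1) (d (j + 1) - 1)) j =
              pieceCount j d j := by
            unfold pieceCount
            rw [Function.update_of_ne (by omega)]
            split_ifs <;> omega
          rw [r3 h, levelFactor, Function.update_self, this]
        · simp
    · rw [if_neg (show ¬ 0 < f j by omega), if_neg (show ¬ 0 < d (j + 1) by omega), add_zero,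
        add_zero]
      split_ifs with h
      · refine Finset.prod_congr rfl fun i hi => ?_
        by_cases hij : i = j
        · subst hij
          simp [levelFactor, show d (i + 1) = 0 by omega, show f i = 0 by omega,
            Nat.multichoose_zero_right]
        · have : pieceCount (j - 1) d i = pieceCount j d i := by
            unfold pieceCount
            split_ifs <;> omega
          simp only [levelFactor, this]
      · obtain rfl : j = 0 := by omega
        by_contra hne
        have hz : ∀ i, i < N → d (i + 1) = 0 ∧ f i = 0 := by
          intro i
          induction i with
          | zero => exact fun _ => ⟨by omega, by omega⟩
          | succ i ih =>
            intro hi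
            have h1 := (ih (by omega)).1
            have h2 : levelFactor 0 f d (i + 1) ≠ 0 :=
              Finset.prod_ne_zero_iff.1 (Ne.symm hne) _ (Finset.mem_range.2 hi)
            by_contra hc
            obtain ⟨k, hk'⟩ := Nat.exists_eq_succ_of_ne_zero
              (show d (i + 1 + 1) + f (i + 1) ≠ 0 by omega)
            apply h2
            rw [levelFactor, hk']
            simp [pieceCount, h1, Nat.multichoose_zero_succ]
        have s1 : ∑ i ∈ Finset.range N, f i = 0 :=
          Finset.sum_eq_zero fun i hi => (hz i (Finset.mem_range.1 hi)).2
        have s2 : ∑ i ∈ Finset.range N, d i = 0 := by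
          refine Finset.sum_eq_zero fun i hi => ?_
          rcases i with _ | i
          · exact hd0
          · have := Finset.mem_range.1 hi
            exact (hz i (by omega)).1
        omega

/-- No two elements share exactly one coordinate: the graph of a partial injection. -/
def IsPartialInjection (s : Finset (ℕ × ℕ)) : Prop :=
  ∀ a b a' b', (a, b) ∈ s → (a', b') ∈ s → (a = a' ↔ b = b')

/-- The part of `s` inside the square `{0, …, k - 1} × {0, …, k - 1}`. -/
def squarePart (k : ℕ) (s : Finset (ℕ × ℕ)) : Finset (ℕ × ℕ) :=
  s.filter fun x => x.1 < k ∧ x.2 < k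

open Classical in
/-- The partial injections of `{0, …, n - 1}`. -/
noncomputable def placements (n : ℕ) : Finset (Finset (ℕ × ℕ)) :=
  (Finset.range n ×ˢ Finset.range n).powerset.filter IsPartialInjection

theorem mem_placements {n : ℕ} {s : Finset (ℕ × ℕ)} :
    s ∈ placements n ↔ (∀ a b, (a, b) ∈ s → a < n ∧ b < n) ∧ IsPartialInjection s := by
  classical
  unfold placements
  rw [Finset.mem_filter, Finset.mem_powerset]
  refine and_congr_left fun _ => ⟨fun h a b hab => ?_, ?_⟩
  · simpa using h hab
  · rintro h ⟨a, b⟩ hab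
    simpa using h a b hab

theorem mem_squarePart {k a b : ℕ} {s : Finset (ℕ × ℕ)} :
    (a, b) ∈ squarePart k s ↔ (a, b) ∈ s ∧ a < k ∧ b < k := by
  simp [squarePart]

theorem squarePart_mem_placements {s : Finset (ℕ × ℕ)} (hs : IsPartialInjection s) (k : ℕ) :
    squarePart k s ∈ placements k := by
  rw [mem_placements]
  refine ⟨fun a b h => (mem_squarePart.1 h).2, fun a b a' b' h h' => ?_⟩
  exact hs a b a' b' (mem_squarePart.1 h).1 (mem_squarePart.1 h').1

open Classical in
/-- The move at `i` of the path of a partial injection. -/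
noncomputable def placementMove (s : Finset (ℕ × ℕ)) (i : ℕ) : Move :=
  if (∃ j < i, (i, j) ∈ s) ∧ (∃ j < i, (j, i) ∈ s) then Move.D
  else if ∃ j ≤ i, (i, j) ∈ s ∨ (j, i) ∈ s then Move.H
  else Move.U

theorem placementMove_squarePart {k i : ℕ} (hi : i < k) (s : Finset (ℕ × ℕ)) :
    placementMove (squarePart k s) i = placementMove s i := by
  have h1 : (∃ j < i, (i, j) ∈ squarePart k s) ↔ ∃ j < i, (i, j) ∈ s :=
    exists_congr fun j => and_congr_right fun hj => by rw [mem_squarePart]; grind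
  have h2 : (∃ j < i, (j, i) ∈ squarePart k s) ↔ ∃ j < i, (j, i) ∈ s :=
    exists_congr fun j => and_congr_right fun hj => by rw [mem_squarePart]; grind
  have h3 : (∃ j ≤ i, (i, j) ∈ squarePart k s ∨ (j, i) ∈ squarePart k s) ↔
      ∃ j ≤ i, (i, j) ∈ s ∨ (j, i) ∈ s :=
    exists_congr fun j => and_congr_right fun hj => by rw [mem_squarePart, mem_squarePart]; grind
  unfold placementMove
  simp only [h1, h2, h3]

/-- The rows of the square that contain no element of `s`. -/
def freeRows (n : ℕ) (s : Finset (ℕ × ℕ)) : Finset ℕ := Finset.range n \ s.image Prod.fst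

/-- The columns of the square that contain no element of `s`. -/
def freeCols (n : ℕ) (s : Finset (ℕ × ℕ)) : Finset ℕ := Finset.range n \ s.image Prod.snd

theorem mem_freeRows {n x : ℕ} {s : Finset (ℕ × ℕ)} :
    x ∈ freeRows n s ↔ x < n ∧ ∀ y, (x, y) ∉ s := by
  simp [freeRows]

theorem mem_freeCols {n x : ℕ} {s : Finset (ℕ × ℕ)} :
    x ∈ freeCols n s ↔ x < n ∧ ∀ y, (y, x) ∉ s := by
  simp [freeCols]

theorem card_freeRows {n : ℕ} {s : Finset (ℕ × ℕ)} (hs : s ∈ placements n) :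
    (freeRows n s).card + s.card = n := by
  rw [mem_placements] at hs
  have h1 : (s.image Prod.fst).card = s.card := by
    refine Finset.card_image_of_injOn ?_
    rintro ⟨a, b⟩ hx ⟨a', b'⟩ hy (h : a = a')
    exact Prod.ext h ((hs.2 a b a' b' hx hy).1 h)
  have h2 : s.image Prod.fst ⊆ Finset.range n := by
    intro a ha
    obtain ⟨⟨a, b⟩, hx, rfl⟩ := Finset.mem_image.1 ha
    exact Finset.mem_range.2 (hs.1 a b hx).1
  have := Finset.card_sdiff_add_card_eq_card h2
  rwa [h1, Finset.card_range] at this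

theorem card_freeCols {n : ℕ} {s : Finset (ℕ × ℕ)} (hs : s ∈ placements n) :
    (freeCols n s).card + s.card = n := by
  rw [mem_placements] at hs
  have h1 : (s.image Prod.snd).card = s.card := by
    refine Finset.card_image_of_injOn ?_
    rintro ⟨a, b⟩ hx ⟨a', b'⟩ hy (h : b = b')
    exact Prod.ext ((hs.2 a b a' b' hx hy).2 h) h
  have h2 : s.image Prod.snd ⊆ Finset.range n := by
    intro a ha
    obtain ⟨⟨a, b⟩, hx, rfl⟩ := Finset.mem_image.1 ha
    exact Finset.mem_range.2 (hs.1 a b hx).2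
  have := Finset.card_sdiff_add_card_eq_card h2
  rwa [h1, Finset.card_range] at this

open Classical in
/-- The partial injections of `{0, …, n}` that extend `s` and have last move `m`. -/
noncomputable def extensions (n : ℕ) (s : Finset (ℕ × ℕ)) (m : Move) :
    Finset (Finset (ℕ × ℕ)) :=
  (placements (n + 1)).filter fun t => squarePart n t = s ∧ placementMove t n = m

theorem mem_extensions {n : ℕ} {s t : Finset (ℕ × ℕ)} {m : Move} :
    t ∈ extensions n s m ↔
      t ∈ placements (n + 1) ∧ squarePart n t = s ∧ placementMove t n = m := by
  classical
  simp [extensions]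

theorem placementMove_eq_U {s : Finset (ℕ × ℕ)} {i : ℕ} :
    placementMove s i = Move.U ↔ ∀ j ≤ i, (i, j) ∉ s ∧ (j, i) ∉ s := by
  unfold placementMove
  split_ifs with h1 h2 <;> simp <;> grind

theorem placementMove_eq_D {s : Finset (ℕ × ℕ)} {i : ℕ} :
    placementMove s i = Move.D ↔ (∃ j < i, (i, j) ∈ s) ∧ (∃ j < i, (j, i) ∈ s) := by
  unfold placementMove
  split_ifs with h1 h2 <;> simp <;> grind

theorem placementMove_eq_H {s : Finset (ℕ × ℕ)} {i : ℕ} :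
    placementMove s i = Move.H ↔ (∃ j ≤ i, (i, j) ∈ s ∨ (j, i) ∈ s) ∧
      ¬ ((∃ j < i, (i, j) ∈ s) ∧ (∃ j < i, (j, i) ∈ s)) := by
  unfold placementMove
  split_ifs with h1 h2 <;> simp <;> grind

theorem extensions_U {n : ℕ} {s : Finset (ℕ × ℕ)} (hs : s ∈ placements n) :
    extensions n s Move.U = {s} := by
  rw [mem_placements] at hs
  obtain ⟨hs1, hs2⟩ := hs
  ext t
  rw [mem_extensions, Finset.mem_singleton, mem_placements, placementMove_eq_U]
  constructor
  · rintro ⟨⟨h1, h2⟩, rfl, h3⟩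
    ext ⟨a, b⟩
    rw [mem_squarePart]
    grind
  · rintro rfl
    refine ⟨⟨by grind, hs2⟩, ?_, by grind⟩
    ext ⟨a, b⟩
    rw [mem_squarePart]
    grind

theorem extensions_D {n : ℕ} {s : Finset (ℕ × ℕ)} (hs : s ∈ placements n) :
    extensions n s Move.D = (freeRows n s ×ˢ freeCols n s).image fun x =>
      insert (x.1, n) (insert (n, x.2) s) := by
  rw [mem_placements] at hs
  obtain ⟨hs1, hs2⟩ := hs
  ext t
  simp only [mem_extensions, Finset.mem_image, Finset.mem_product, mem_placements,
    placementMove_eq_D, mem_freeRows, mem_freeCols, Prod.exists]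
  constructor
  · rintro ⟨⟨h1, h2⟩, rfl, ⟨y, hy, hy'⟩, ⟨x, hx, hx'⟩⟩
    refine ⟨x, y, ⟨⟨hx, ?_⟩, hy, ?_⟩, ?_⟩
    · intro b hb
      rw [mem_squarePart] at hb
      have := h2 _ _ _ _ hx' hb.1
      omega
    · intro b hb
      rw [mem_squarePart] at hb
      have := h2 _ _ _ _ hy' hb.1
      omega
    · ext ⟨a, b⟩
      simp only [Finset.mem_insert, mem_squarePart, Prod.mk.injEq]
      constructor
      · rintro (⟨rfl, rfl⟩ | ⟨rfl, rfl⟩ | h)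
        exacts [hx', hy', h.1]
      · intro h
        have e1 := h1 _ _ h
        have e2 := h2 _ _ _ _ hx' h
        have e3 := h2 _ _ _ _ hy' h
        by_cases ha : a = n
        · exact Or.inr (Or.inl ⟨ha, by omega⟩)
        · by_cases hb : b = n
          · exact Or.inl ⟨by omega, hb⟩
          · exact Or.inr (Or.inr ⟨h, by omega, by omega⟩)
  · rintro ⟨x, y, ⟨⟨hx, hx'⟩, hy, hy'⟩, rfl⟩
    refine ⟨⟨?_, ?_⟩, ?_, ⟨y, hy, by simp⟩, ⟨x, hx, by simp⟩⟩
    · intro a b h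
      simp only [Finset.mem_insert, Prod.mk.injEq] at h
      grind
    · intro a b a' b' h h'
      simp only [Finset.mem_insert, Prod.mk.injEq] at h h'
      have e1 := hs1 a b
      have e2 := hs1 a' b'
      have e3 := hs2 a b a' b'
      grind
    · ext ⟨a, b⟩
      simp only [Finset.mem_insert, mem_squarePart, Prod.mk.injEq]
      have e1 := hs1 a b
      grind

theorem extensions_H {n : ℕ} {s : Finset (ℕ × ℕ)} (hs : s ∈ placements n) :
    extensions n s Move.H = insert (insert (n, n) s)
      (((freeRows n s).image fun x => insert (x, n) s) ∪
        (freeCols n s).image fun y => insert (n, y) s) := by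
  rw [mem_placements] at hs
  obtain ⟨hs1, hs2⟩ := hs
  ext t
  simp only [mem_extensions, Finset.mem_image, Finset.mem_union, mem_placements,
    placementMove_eq_H, mem_freeRows, mem_freeCols, Finset.mem_insert]
  constructor
  · rintro ⟨⟨h1, h2⟩, rfl, ⟨j, hj, hj'⟩, h3⟩
    by_cases hn : (n, n) ∈ t
    · left
      ext ⟨a, b⟩
      simp only [Finset.mem_insert, mem_squarePart, Prod.mk.injEq]
      have e1 := h1 a b
      have e2 := h2 n n a b hn
      grind
    · right
      rcases hj' with hj' | hj'
      · right
        refine ⟨j, ⟨by grind, fun y hy => ?_⟩, ?_⟩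
        · rw [mem_squarePart] at hy
          have := h2 _ _ _ _ hj' hy.1
          omega
        · ext ⟨a, b⟩
          simp only [Finset.mem_insert, mem_squarePart, Prod.mk.injEq]
          have e1 := h1 a b
          have e2 := h2 _ _ a b hj'
          grind
      · left
        refine ⟨j, ⟨by grind, fun y hy => ?_⟩, ?_⟩
        · rw [mem_squarePart] at hy
          have := h2 _ _ _ _ hj' hy.1
          omega
        · ext ⟨a, b⟩
          simp only [Finset.mem_insert, mem_squarePart, Prod.mk.injEq]
          have e1 := h1 a b
          have e2 := h2 _ _ a b hj'
          grind
  · rintro (rfl | ⟨x, ⟨hx, hx'⟩, rfl⟩ | ⟨y, ⟨hy, hy'⟩, rfl⟩)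
    · refine ⟨⟨?_, ?_⟩, ?_, ⟨n, le_rfl, by simp⟩, ?_⟩
      · intro a b h
        simp only [Finset.mem_insert, Prod.mk.injEq] at h
        grind
      · intro a b a' b' h h'
        simp only [Finset.mem_insert, Prod.mk.injEq] at h h'
        have e1 := hs1 a b
        have e2 := hs1 a' b'
        have e3 := hs2 a b a' b'
        grind
      · ext ⟨a, b⟩
        simp only [Finset.mem_insert, mem_squarePart, Prod.mk.injEq]
        have e1 := hs1 a b
        grind
      · simp only [Finset.mem_insert, Prod.mk.injEq]
        grind
    · refine ⟨⟨?_, ?_⟩, ?_, ⟨x, hx.le, by simp⟩, ?_⟩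
      · intro a b h
        simp only [Finset.mem_insert, Prod.mk.injEq] at h
        grind
      · intro a b a' b' h h'
        simp only [Finset.mem_insert, Prod.mk.injEq] at h h'
        have e1 := hs1 a b
        have e2 := hs1 a' b'
        have e3 := hs2 a b a' b'
        grind
      · ext ⟨a, b⟩
        simp only [Finset.mem_insert, mem_squarePart, Prod.mk.injEq]
        have e1 := hs1 a b
        grind
      · simp only [Finset.mem_insert, Prod.mk.injEq]
        grind
    · refine ⟨⟨?_, ?_⟩, ?_, ⟨y, hy.le, by simp⟩, ?_⟩
      · intro a b h
        simp only [Finset.mem_insert, Prod.mk.injEq] at h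
        grind
      · intro a b a' b' h h'
        simp only [Finset.mem_insert, Prod.mk.injEq] at h h'
        have e1 := hs1 a b
        have e2 := hs1 a' b'
        have e3 := hs2 a b a' b'
        grind
      · ext ⟨a, b⟩
        simp only [Finset.mem_insert, mem_squarePart, Prod.mk.injEq]
        have e1 := hs1 a b
        grind
      · simp only [Finset.mem_insert, Prod.mk.injEq]
        grind

/-- The number of ways to continue a partial injection with `h` free rows and columns by a given
move. -/
def Move.choices (m : Move) (h : ℤ) : ℤ :=
  match m with
  | .U => 1
  | .H => 2 * h + 1
  | .D => h ^ 2

theorem card_extensions {n : ℕ} {s : Finset (ℕ × ℕ)} (hs : s ∈ placements n) (m : Move) :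
    ((extensions n s m).card : ℤ) = m.choices (n - s.card) := by
  have hR := card_freeRows hs
  have hC := card_freeCols hs
  have hsn := (mem_placements.1 hs).1
  have hn1 : ∀ y, (n, y) ∉ s := fun y hy => by have := hsn _ _ hy; omega
  have hn2 : ∀ y, (y, n) ∉ s := fun y hy => by have := hsn _ _ hy; omega
  cases m with
  | U => simp [extensions_U hs, Move.choices]
  | D =>
    rw [extensions_D hs, Finset.card_image_of_injOn, Finset.card_product]
    · have e1 : ((freeRows n s).card : ℤ) = n - s.card := by omega
      have e2 : ((freeCols n s).card : ℤ) = n - s.card := by omega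
      push_cast
      rw [e1, e2, Move.choices]
      ring
    · rintro ⟨x, y⟩ hx ⟨x', y'⟩ hx' h
      simp only [Finset.coe_product, Set.mem_prod, Finset.mem_coe, mem_freeRows,
        mem_freeCols] at hx hx'
      have h1 := Finset.ext_iff.1 h (x, n)
      have h2 := Finset.ext_iff.1 h (n, y)
      simp only [Finset.mem_insert, Prod.mk.injEq] at h1 h2
      grind
  | H =>
    rw [extensions_H hs, Finset.card_insert_of_notMem, Finset.card_union_of_disjoint,
      Finset.card_image_of_injOn, Finset.card_image_of_injOn]
    · simp only [Move.choices]
      omega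
    · intro x hx x' hx' h
      simp only [Finset.mem_coe, mem_freeCols] at hx hx'
      have h1 := Finset.ext_iff.1 h (n, x)
      simp only [Finset.mem_insert, Prod.mk.injEq] at h1
      grind
    · intro x hx x' hx' h
      simp only [Finset.mem_coe, mem_freeRows] at hx hx'
      have h1 := Finset.ext_iff.1 h (x, n)
      simp only [Finset.mem_insert, Prod.mk.injEq] at h1
      grind
    · rw [Finset.disjoint_left]
      intro t h1 h2
      simp only [Finset.mem_image, mem_freeRows, mem_freeCols] at h1 h2
      obtain ⟨x, hx, rfl⟩ := h1
      obtain ⟨y, hy, h⟩ := h2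
      have h1 := Finset.ext_iff.1 h (x, n)
      simp only [Finset.mem_insert, Prod.mk.injEq] at h1
      grind
    · intro h
      simp only [Finset.mem_union, Finset.mem_image, mem_freeRows, mem_freeCols] at h
      rcases h with ⟨x, hx, h⟩ | ⟨x, hx, h⟩ <;>
      · have h1 := Finset.ext_iff.1 h (n, n)
        simp only [Finset.mem_insert, Prod.mk.injEq] at h1
        grind

theorem card_of_mem_extensions {n : ℕ} {s t : Finset (ℕ × ℕ)} {m : Move} (hs : s ∈ placements n)
    (ht : t ∈ extensions n s m) : (t.card : ℤ) + m.rise = s.card + 1 := by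
  have hsn := (mem_placements.1 hs).1
  have hn1 : ∀ y, (n, y) ∉ s := fun y hy => by have := hsn _ _ hy; omega
  have hn2 : ∀ y, (y, n) ∉ s := fun y hy => by have := hsn _ _ hy; omega
  cases m with
  | U =>
    rw [extensions_U hs, Finset.mem_singleton] at ht
    simp [ht, Move.rise]
  | D =>
    rw [extensions_D hs, Finset.mem_image] at ht
    obtain ⟨⟨x, y⟩, hxy, rfl⟩ := ht
    simp only [Finset.mem_product, mem_freeRows, mem_freeCols] at hxy
    rw [Finset.card_insert_of_notMem, Finset.card_insert_of_notMem (hn1 _)]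
    · simp [Move.rise]
    · simp only [Finset.mem_insert, Prod.mk.injEq]
      grind
  | H =>
    simp only [extensions_H hs, Finset.mem_insert, Finset.mem_union, Finset.mem_image] at ht
    rcases ht with rfl | ⟨x, hx, rfl⟩ | ⟨x, hx, rfl⟩
    · rw [Finset.card_insert_of_notMem (hn1 _)]
      simp [Move.rise]
    · rw [Finset.card_insert_of_notMem (hn2 _)]
      simp [Move.rise]
    · rw [Finset.card_insert_of_notMem (hn1 _)]
      simp [Move.rise]

theorem squarePart_squarePart (k : ℕ) (s : Finset (ℕ × ℕ)) :
    squarePart k (squarePart (k + 1) s) = squarePart k s := by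
  ext ⟨a, b⟩
  simp only [mem_squarePart]
  grind

theorem sum_rise_placementMove {s : Finset (ℕ × ℕ)} (hs : IsPartialInjection s) (k : ℕ) :
    ∑ i ∈ Finset.range k, (placementMove s i).rise = k - (squarePart k s).card := by
  induction k with
  | zero => simp [squarePart]
  | succ k ih =>
    have h := card_of_mem_extensions (squarePart_mem_placements hs k)
      (mem_extensions.2 ⟨squarePart_mem_placements hs (k + 1), squarePart_squarePart k s, rfl⟩)
    rw [placementMove_squarePart (Nat.lt_succ_self k)] at h
    rw [Finset.sum_range_succ, ih]
    push_cast
    linarith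

theorem squarePart_eq_self {n : ℕ} {s : Finset (ℕ × ℕ)} (hs : s ∈ placements n) :
    squarePart n s = s := by
  ext ⟨a, b⟩
  have := (mem_placements.1 hs).1 a b
  rw [mem_squarePart]
  grind

open Classical in
/-- The partial injections of `{0, …, n - 1}` whose path begins with the first `n` moves of `w`. -/
noncomputable def placementsOfMoves (w : ℕ → Move) (n : ℕ) : Finset (Finset (ℕ × ℕ)) :=
  (placements n).filter fun s => ∀ i < n, placementMove s i = w i

theorem mem_placementsOfMoves {w : ℕ → Move} {n : ℕ} {s : Finset (ℕ × ℕ)} :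
    s ∈ placementsOfMoves w n ↔ s ∈ placements n ∧ ∀ i < n, placementMove s i = w i := by
  classical
  simp [placementsOfMoves]

theorem card_placementsOfMoves (w : ℕ → Move) (n : ℕ) :
    ((placementsOfMoves w n).card : ℤ) =
      ∏ i ∈ Finset.range n, (w i).choices (∑ j ∈ Finset.range i, (w j).rise) := by
  induction n with
  | zero =>
    have : placementsOfMoves w 0 = {∅} := by
      ext s
      simp only [mem_placementsOfMoves, mem_placements, Finset.mem_singleton]
      constructor
      · rintro ⟨⟨h, -⟩, -⟩
        refine Finset.eq_empty_of_forall_notMem ?_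
        rintro ⟨a, b⟩ hab
        have := h a b hab
        omega
      · rintro rfl
        refine ⟨⟨by simp, ?_⟩, by simp⟩
        intro a b a' b' h
        simp at h
    rw [this]
    simp
  | succ n ih =>
    rw [Finset.prod_range_succ, ← ih]
    rw [Finset.card_eq_sum_card_fiberwise (f := squarePart n)
      (t := placementsOfMoves w n)]
    · rw [← nsmul_eq_mul, ← Finset.sum_const]
      push_cast
      refine Finset.sum_congr rfl fun s hs => ?_
      rw [mem_placementsOfMoves] at hs
      have hh : ∑ j ∈ Finset.range n, (w j).rise = n - s.card := by
        rw [← Finset.sum_congr rfl fun j hj => congrArg Move.rise (hs.2 j (Finset.mem_range.1 hj)),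
          sum_rise_placementMove (mem_placements.1 hs.1).2, squarePart_eq_self hs.1]
      rw [hh, ← card_extensions hs.1]
      congr 2
      ext t
      rw [Finset.mem_filter, mem_placementsOfMoves, mem_extensions]
      constructor
      · rintro ⟨⟨h1, h2⟩, h3⟩
        exact ⟨h1, h3, h2 n (Nat.lt_succ_self n)⟩
      · rintro ⟨h1, h2, h3⟩
        refine ⟨⟨h1, fun i hi => ?_⟩, h2⟩
        rcases Nat.lt_succ_iff_lt_or_eq.1 hi with h | rfl
        · rw [← hs.2 i h, ← h2, placementMove_squarePart h]
        · exact h3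
    · intro t ht
      simp only [Finset.mem_coe, mem_placementsOfMoves] at ht ⊢
      refine ⟨squarePart_mem_placements (mem_placements.1 ht.1).2 n, fun i hi => ?_⟩
      rw [placementMove_squarePart hi, ht.2 i (by omega)]

section PermutationPaths

variable {n : ℕ}

/-- The graph of a permutation. -/
def permGraph (π : Equiv.Perm (Fin n)) : Finset (ℕ × ℕ) :=
  Finset.univ.image fun i => (i.val, (π i).val)

theorem mem_permGraph {π : Equiv.Perm (Fin n)} {a b : ℕ} :
    (a, b) ∈ permGraph π ↔ ∃ i, i.val = a ∧ (π i).val = b := by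
  simp [permGraph]

theorem permGraph_mem_row {π : Equiv.Perm (Fin n)} {i : Fin n} {b : ℕ} :
    (i.val, b) ∈ permGraph π ↔ (π i).val = b := by
  rw [mem_permGraph]
  constructor
  · rintro ⟨j, hj, h⟩
    rwa [← Fin.ext hj]
  · exact fun h => ⟨i, rfl, h⟩

theorem permGraph_mem_col {π : Equiv.Perm (Fin n)} {i : Fin n} {a : ℕ} :
    (a, i.val) ∈ permGraph π ↔ (π.symm i).val = a := by
  rw [mem_permGraph]
  constructor
  · rintro ⟨j, hj, h⟩
    rw [← Fin.ext h, Equiv.symm_apply_apply, hj]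
  · exact fun h => ⟨π.symm i, h, by simp⟩

theorem permGraph_mem_placements (π : Equiv.Perm (Fin n)) : permGraph π ∈ placements n := by
  rw [mem_placements]
  constructor
  · intro a b h
    obtain ⟨i, rfl, rfl⟩ := mem_permGraph.1 h
    exact ⟨i.isLt, (π i).isLt⟩
  · intro a b a' b' h h'
    obtain ⟨i, rfl, rfl⟩ := mem_permGraph.1 h
    obtain ⟨j, rfl, rfl⟩ := mem_permGraph.1 h'
    rw [← Fin.ext_iff, ← Fin.ext_iff, π.injective.eq_iff]

theorem permPath_eq_placementMove (π : Equiv.Perm (Fin n)) (i : Fin n) :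
    permPath π i = placementMove (permGraph π) i.val := by
  unfold permPath
  simp only [Fin.lt_def]
  split_ifs with h1 h2
  · symm
    rw [placementMove_eq_U]
    intro j hj
    rw [permGraph_mem_row, permGraph_mem_col]
    omega
  · symm
    rw [placementMove_eq_D]
    exact ⟨⟨_, h2.1, permGraph_mem_row.2 rfl⟩, ⟨_, h2.2, permGraph_mem_col.2 rfl⟩⟩
  · symm
    rw [placementMove_eq_H]
    constructor
    · rcases not_and_or.1 h1 with h | h
      · exact ⟨_, not_lt.1 h, Or.inl (permGraph_mem_row.2 rfl)⟩
      · exact ⟨_, not_lt.1 h, Or.inr (permGraph_mem_col.2 rfl)⟩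
    · rintro ⟨⟨j, hj, hj'⟩, ⟨k, hk, hk'⟩⟩
      rw [permGraph_mem_row] at hj'
      rw [permGraph_mem_col] at hk'
      omega

/-- The word `w`, continued by flats. -/
def extendMoves (w : Fin n → Move) (i : ℕ) : Move := if h : i < n then w ⟨i, h⟩ else Move.H

theorem extendMoves_val (w : Fin n → Move) (i : Fin n) : extendMoves w i.val = w i := by
  simp [extendMoves]

theorem sum_rise_extendMoves (w : Fin n → Move) {k : ℕ} (hk : k ≤ n) :
    ∑ i ∈ Finset.range k, (extendMoves w i).rise = pathHeight w k := by
  induction k with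
  | zero => simp [pathHeight_zero]
  | succ k ih =>
    have h1 := pathHeight_succ w ⟨k, hk⟩
    have h2 := extendMoves_val w ⟨k, hk⟩
    simp only at h1 h2
    rw [Finset.sum_range_succ, ih (by omega), h1, h2]

theorem pathHeight_permPath_eq_sub (π : Equiv.Perm (Fin n)) {k : ℕ} (hk : k ≤ n) :
    pathHeight (permPath π) k =
      k - (Finset.univ.filter fun i : Fin n => i.val < k ∧ (π i).val < k).card := by
  rw [← sum_rise_extendMoves _ hk]
  have h : ∀ i ∈ Finset.range k, (extendMoves (permPath π) i).rise =
      (placementMove (permGraph π) i).rise := by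
    intro i hi
    have hi' : i < n := by have := Finset.mem_range.1 hi; omega
    have h1 := extendMoves_val (permPath π) ⟨i, hi'⟩
    rw [permPath_eq_placementMove] at h1
    exact congrArg _ h1
  rw [Finset.sum_congr rfl h,
    sum_rise_placementMove (mem_placements.1 (permGraph_mem_placements π)).2]
  congr 2
  unfold squarePart permGraph
  rw [Finset.filter_image, Finset.card_image_of_injective]
  intro i j hij
  exact Fin.ext (Prod.mk.inj hij).1

theorem card_filter_val_lt {k : ℕ} (hk : k ≤ n) :
    (Finset.univ.filter fun i : Fin n => i.val < k).card = k := by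
  rw [Fin.card_filter_val_lt, min_eq_right hk]

theorem pathHeight_permPath (π : Equiv.Perm (Fin n)) {k : ℕ} (hk : k ≤ n) :
    pathHeight (permPath π) k =
      (Finset.univ.filter fun i : Fin n => i.val < k ∧ k ≤ (π i).val).card := by
  have h1 := Finset.card_filter_add_card_filter_not
    (s := Finset.univ.filter fun i : Fin n => i.val < k) (fun i => (π i).val < k)
  rw [Finset.filter_filter, Finset.filter_filter, card_filter_val_lt hk] at h1
  simp only [not_lt] at h1
  rw [pathHeight_permPath_eq_sub π hk]
  omega

theorem pathHeight_permPath' (π : Equiv.Perm (Fin n)) {k : ℕ} (hk : k ≤ n) :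
    pathHeight (permPath π) k =
      (Finset.univ.filter fun i : Fin n => (π i).val < k ∧ k ≤ i.val).card := by
  have h1 := Finset.card_filter_add_card_filter_not
    (s := Finset.univ.filter fun i : Fin n => (π i).val < k) (fun i => i.val < k)
  have h2 : (Finset.univ.filter fun i : Fin n => (π i).val < k).card = k := by
    refine Eq.trans ?_ (card_filter_val_lt hk)
    rw [Finset.card_filter, Finset.card_filter]
    exact Equiv.sum_comp π fun i : Fin n => if i.val < k then 1 else 0
  rw [Finset.filter_filter, Finset.filter_filter, h2] at h1
  simp only [not_lt] at h1
  rw [pathHeight_permPath_eq_sub π hk]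
  simp only [and_comm (a := (π _).val < k)] at h1 ⊢
  omega

theorem isMotzkin_permPath (π : Equiv.Perm (Fin n)) : IsMotzkin (permPath π) := by
  constructor
  · intro k hk
    rw [pathHeight_permPath π hk]
    exact Int.natCast_nonneg _
  · rw [pathHeight_permPath π le_rfl, Finset.filter_false_of_mem]
    · simp
    · rintro i - ⟨-, h⟩
      have := (π i).isLt
      omega

theorem pathArea_eq_sum (w : Fin n → Move) (hw : pathHeight w n = 0) :
    pathArea w = ∑ k ∈ Finset.range n, (pathHeight w k : ℚ) := by
  unfold pathArea
  rw [Fin.sum_univ_eq_sum_range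
    (fun i => ((pathHeight w i : ℚ) + (pathHeight w (i + 1) : ℚ)) / 2) n, ← Finset.sum_div,
    Finset.sum_add_distrib]
  have h1 := Finset.sum_range_succ (fun k => (pathHeight w k : ℚ)) n
  have h2 := Finset.sum_range_succ' (fun k => (pathHeight w k : ℚ)) n
  simp only [hw, pathHeight_zero, Int.cast_zero, add_zero] at h1 h2
  rw [← h2, h1]
  ring

theorem natAbs_eq_card_filter {a b : ℕ} (ha : a < n) (hb : b < n) :
    ((a : ℤ) - b).natAbs = ∑ k ∈ Finset.range n,
      ((if a < k ∧ k ≤ b then 1 else 0) + if b < k ∧ k ≤ a then 1 else 0) := by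
  rw [Finset.sum_add_distrib, ← Finset.card_filter, ← Finset.card_filter]
  have h1 : (Finset.range n).filter (fun k => a < k ∧ k ≤ b) = Finset.Ioc a b := by
    ext k
    simp only [Finset.mem_filter, Finset.mem_range, Finset.mem_Ioc]
    omega
  have h2 : (Finset.range n).filter (fun k => b < k ∧ k ≤ a) = Finset.Ioc b a := by
    ext k
    simp only [Finset.mem_filter, Finset.mem_range, Finset.mem_Ioc]
    omega
  rw [h1, h2, Nat.card_Ioc, Nat.card_Ioc]
  omega

theorem totalDisplacement_eq (π : Equiv.Perm (Fin n)) :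
    (totalDisplacement π : ℚ) = 2 * pathArea (permPath π) := by
  rw [pathArea_eq_sum _ (isMotzkin_permPath π).2]
  have h : (totalDisplacement π : ℤ) = 2 * ∑ k ∈ Finset.range n, pathHeight (permPath π) k := by
    unfold totalDisplacement
    rw [Finset.sum_congr rfl fun i _ => natAbs_eq_card_filter i.isLt (π i).isLt,
      Finset.sum_comm, Nat.cast_sum, Finset.mul_sum]
    refine Finset.sum_congr rfl fun k hk => ?_
    have hk' := (Finset.mem_range.1 hk).le
    rw [Finset.sum_add_distrib, ← Finset.card_filter, ← Finset.card_filter, Nat.cast_add, two_mul]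
    congr 1
    · rw [pathHeight_permPath π hk']
    · rw [pathHeight_permPath' π hk']
  exact_mod_cast h

theorem exists_perm_of_placement {s : Finset (ℕ × ℕ)} (hs : s ∈ placements n)
    (hc : s.card = n) : ∃ π : Equiv.Perm (Fin n), permGraph π = s := by
  have hrow : ∀ i : Fin n, ∃ j : Fin n, (i.val, j.val) ∈ s := by
    intro i
    have h0 : freeRows n s = ∅ := by
      have := card_freeRows hs
      exact Finset.card_eq_zero.1 (by omega)
    have h1 : i.val ∉ freeRows n s := by simp [h0]
    rw [mem_freeRows] at h1
    push Not at h1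
    obtain ⟨y, hy⟩ := h1 i.isLt
    exact ⟨⟨y, ((mem_placements.1 hs).1 _ _ hy).2⟩, hy⟩
  choose g hg using hrow
  have hinj : Function.Injective g := by
    intro i j hij
    have := hg j
    rw [← hij] at this
    exact Fin.ext (((mem_placements.1 hs).2 _ _ _ _ (hg i) this).2 rfl)
  refine ⟨Equiv.ofBijective g (Finite.injective_iff_bijective.1 hinj), ?_⟩
  ext ⟨a, b⟩
  rw [mem_permGraph]
  constructor
  · rintro ⟨i, rfl, rfl⟩
    exact hg i
  · intro h
    have ha := ((mem_placements.1 hs).1 _ _ h).1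
    exact ⟨⟨a, ha⟩, rfl, ((mem_placements.1 hs).2 _ _ _ _ (hg ⟨a, ha⟩) h).1 rfl⟩

theorem card_permPath_eq (w : Fin n → Move) (hw : pathHeight w n = 0) :
    (Finset.univ.filter fun π : Equiv.Perm (Fin n) => permPath π = w).card =
      (placementsOfMoves (extendMoves w) n).card := by
  refine Finset.card_bij (fun π _ => permGraph π) ?_ ?_ ?_
  · intro π hπ
    rw [Finset.mem_filter_univ] at hπ
    refine mem_placementsOfMoves.2 ⟨permGraph_mem_placements π, fun i hi => ?_⟩
    rw [← permPath_eq_placementMove π ⟨i, hi⟩, hπ]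
    exact (extendMoves_val w ⟨i, hi⟩).symm
  · intro π _ σ _ h
    ext i
    have h1 : (i.val, (π i).val) ∈ permGraph σ := h ▸ permGraph_mem_row.2 rfl
    exact (permGraph_mem_row.1 h1).symm
  · intro s hs
    rw [mem_placementsOfMoves] at hs
    have hc : s.card = n := by
      have h1 := sum_rise_placementMove (mem_placements.1 hs.1).2 n
      rw [Finset.sum_congr rfl fun i hi => congrArg Move.rise (hs.2 i (Finset.mem_range.1 hi)),
        sum_rise_extendMoves w le_rfl, hw, squarePart_eq_self hs.1] at h1
      omega
    obtain ⟨π, rfl⟩ := exists_perm_of_placement hs.1 hc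
    refine ⟨π, ?_, rfl⟩
    rw [Finset.mem_filter_univ]
    funext i
    rw [permPath_eq_placementMove, hs.2 i i.isLt, extendMoves_val]

theorem prod_choices_mul_factorial (w : Fin n → Move) (hw : StaysNonneg w) :
    (∏ i : Fin n, (w i).choices (pathHeight w i)) * ((pathHeight w n).toNat.factorial : ℤ) =
      pathWeight w := by
  induction n with
  | zero => simp [pathWeight, pathHeight]
  | succ n ih =>
    obtain ⟨v, m, rfl⟩ : ∃ (v : Fin n → Move) (m : Move), w = Fin.snoc v m :=
      ⟨Fin.init w, w (Fin.last n), (Fin.snoc_init_self w).symm⟩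
    obtain ⟨h1, h2⟩ := (staysNonneg_snoc v m).1 hw
    have h3 : pathWeight (Fin.snoc v m : Fin (n + 1) → Move) = pathWeight v *
        if m = Move.H then 2 * (pathHeight v n + if m = Move.U then 1 else 0) + 1
        else pathHeight v n + if m = Move.U then 1 else 0 := by
      unfold pathWeight
      rw [Fin.prod_univ_castSucc]
      simp only [Fin.snoc_castSucc, Fin.snoc_last, moveHeight_snoc_castSucc, moveHeight_snoc_last]
    have h4 : ∀ i : Fin n, pathHeight (Fin.snoc v m : Fin (n + 1) → Move) i.val =
        pathHeight v i.val := fun i => pathHeight_snoc v m i.isLt.le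
    rw [h3, ← ih v h1, Fin.prod_univ_castSucc]
    simp only [Fin.snoc_castSucc, Fin.snoc_last, Fin.val_castSucc, Fin.val_last, h4,
      pathHeight_snoc v m le_rfl, pathHeight_snoc_last]
    obtain ⟨h, hh⟩ := Int.eq_ofNat_of_zero_le (h1 n le_rfl)
    rw [hh] at h2 ⊢
    cases m with
    | U =>
      simp only [Move.choices, Move.rise, reduceCtorEq, if_false, if_true]
      rw [show ((h : ℤ) + 1).toNat = h + 1 by omega, Int.toNat_natCast, Nat.factorial_succ]
      push_cast
      ring
    | H =>
      simp only [Move.choices, Move.rise, reduceCtorEq, if_false, if_true, add_zero]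
      ring
    | D =>
      simp only [Move.rise] at h2
      obtain ⟨h, rfl⟩ := Nat.exists_eq_succ_of_ne_zero (show h ≠ 0 by omega)
      simp only [Move.choices, Move.rise, reduceCtorEq, if_false, add_zero]
      rw [show ((h.succ : ℕ) : ℤ) + -1 = (h : ℤ) by push_cast; ring, Int.toNat_natCast,
        Int.toNat_natCast, Nat.factorial_succ]
      push_cast
      ring

/-- The number of permutations with a given Motzkin path is the weight of the path. -/
theorem card_permPath_eq_pathWeight (w : Fin n → Move) (hw : IsMotzkin w) :
    ((Finset.univ.filter fun π : Equiv.Perm (Fin n) => permPath π = w).card : ℤ) =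
      pathWeight w := by
  rw [card_permPath_eq w hw.2, card_placementsOfMoves, ← prod_choices_mul_factorial w hw.1, hw.2,
    ← Fin.prod_univ_eq_prod_range
      (fun i => (extendMoves w i).choices (∑ j ∈ Finset.range i, (extendMoves w j).rise)) n]
  simp only [Int.toNat_zero, Nat.factorial_zero, Nat.cast_one, mul_one]
  refine Finset.prod_congr rfl fun i _ => ?_
  rw [extendMoves_val, sum_rise_extendMoves w i.isLt.le]

end PermutationPaths

@[to_additive]
theorem prod_Icc_eq_prod_range {M : Type*} [CommMonoid M] (F : ℕ → M) (h : ℕ)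
    (h0 : F 0 = 1) : ∏ i ∈ Finset.Icc 1 h, F i = ∏ i ∈ Finset.range (h + 1), F i := by
  refine Finset.prod_subset ?_ ?_
  · intro i hi
    rw [Finset.mem_Icc] at hi
    exact Finset.mem_range.2 (by omega)
  · intro i hi hi'
    rw [Finset.mem_range] at hi
    rw [Finset.mem_Icc] at hi'
    obtain rfl : i = 0 := by omega
    exact h0

namespace IsBuiltFrom

variable {n : ℕ} {w : Fin n → Move} {a : BuildingSequence}

theorem moveHeight_le (hw : IsBuiltFrom w a) (j : Fin n) : (moveHeight w j).toNat ≤ a.h := by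
  by_contra hc
  have h0 := Int.toNat_of_nonneg (moveHeight_nonneg w hw.1.1 j)
  have h1 := hw.2 (moveHeight w j).toNat
  rw [a.f_eq_zero _ (not_le.1 hc), a.p_eq_zero _ (not_le.1 hc)] at h1
  simp only [Finset.card_eq_zero, Finset.filter_eq_empty_iff] at h1
  obtain ⟨hH, hU, hD⟩ := h1
  cases hm : w j
  · exact hU (Finset.mem_univ j) ⟨hm, h0.symm⟩
  · exact hH (Finset.mem_univ j) ⟨hm, h0.symm⟩
  · exact hD (Finset.mem_univ j) ⟨hm, h0.symm⟩

@[to_additive]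
theorem prod_moves {M : Type*} [CommMonoid M] (hw : IsBuiltFrom w a) (g : Move → ℕ → M) :
    ∏ j, g (w j) (moveHeight w j).toNat =
      (∏ i ∈ Finset.range (a.h + 1), g Move.H i ^ a.f i) *
        ∏ i ∈ Finset.Icc 1 a.h, (g Move.U i * g Move.D i) ^ a.p i := by
  have key : ∀ m : Move, ∀ i : ℕ,
      ∏ j ∈ Finset.univ.filter (fun j => (w j, (moveHeight w j).toNat) = (m, i)),
        g (w j) (moveHeight w j).toNat = g m i ^ moveCount w m i := by
    intro m i
    have h1 : (Finset.univ.filter fun j => (w j, (moveHeight w j).toNat) = (m, i)) =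
        Finset.univ.filter fun j => w j = m ∧ moveHeight w j = i := by
      refine Finset.filter_congr fun j _ => ?_
      have := moveHeight_nonneg w hw.1.1 j
      rw [Prod.mk.injEq]
      refine and_congr_right fun _ => ?_
      omega
    rw [moveCount, ← h1, ← Finset.prod_const]
    refine Finset.prod_congr rfl fun j hj => ?_
    have h2 := (Finset.mem_filter.1 hj).2
    rw [Prod.mk.injEq] at h2
    rw [h2.1, h2.2]
  rw [← Finset.prod_fiberwise_of_maps_to
    (t := (Finset.univ : Finset Move) ×ˢ Finset.range (a.h + 1))
    (g := fun j => (w j, (moveHeight w j).toNat)), Finset.prod_product]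
  · simp only [key]
    rw [Move.univ_eq, Finset.prod_insert (by decide), Finset.prod_insert (by decide),
      Finset.prod_singleton, mul_left_comm, ← Finset.prod_mul_distrib,
      prod_Icc_eq_prod_range _ _ (by rw [a.p_zero, pow_zero])]
    congr 1
    · exact Finset.prod_congr rfl fun i _ => congrArg _ (hw.2 i).1
    · refine Finset.prod_congr rfl fun i _ => ?_
      rw [mul_pow]
      exact congrArg₂ _ (congrArg _ (hw.2 i).2.1) (congrArg _ (hw.2 i).2.2)
  · intro j _
    rw [Finset.mem_product, Finset.mem_range]
    exact ⟨Finset.mem_univ _, Nat.lt_succ_of_le (hw.moveHeight_le j)⟩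

theorem width_eq (hw : IsBuiltFrom w a) : a.width = n := by
  have h := hw.sum_moves fun _ _ => 1
  simp only [Finset.sum_const, Finset.card_univ, Fintype.card_fin, smul_eq_mul, mul_one] at h
  rw [h, BuildingSequence.width, ← Finset.sum_mul]
  ring

theorem pathArea_eq (hw : IsBuiltFrom w a) : pathArea w = a.area := by
  have h := hw.sum_moves fun m i => if m = Move.H then (i : ℚ) else i - 1 / 2
  have h1 : pathArea w = ∑ j, if w j = Move.H then (((moveHeight w j).toNat : ℕ) : ℚ)
      else ((moveHeight w j).toNat : ℕ) - 1 / 2 := by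
    unfold pathArea
    refine Finset.sum_congr rfl fun j _ => ?_
    have h0 : (((moveHeight w j).toNat : ℕ) : ℚ) = (moveHeight w j : ℚ) := by
      exact_mod_cast congrArg (Int.cast : ℤ → ℚ)
        (Int.toNat_of_nonneg (moveHeight_nonneg w hw.1.1 j))
    rw [h0, moveHeight_eq, pathHeight_succ]
    cases w j <;> simp [Move.rise] <;> ring
  rw [h1, h, BuildingSequence.area]
  push_cast
  congr 1
  · refine Finset.sum_congr rfl fun i _ => ?_
    simp [mul_comm]
  · refine Finset.sum_congr rfl fun i hi => ?_
    have hi' := (Finset.mem_Icc.1 hi).1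
    rw [nsmul_eq_mul, Nat.cast_sub (by omega)]
    push_cast
    ring

theorem pathWeight_eq (hw : IsBuiltFrom w a) : pathWeight w = a.perm := by
  have h := hw.prod_moves fun m i => if m = Move.H then 2 * (i : ℤ) + 1 else i
  have h1 : pathWeight w = ∏ j, if w j = Move.H then 2 * (((moveHeight w j).toNat : ℕ) : ℤ) + 1
      else ((moveHeight w j).toNat : ℕ) := by
    unfold pathWeight
    refine Finset.prod_congr rfl fun j _ => ?_
    rw [Int.toNat_of_nonneg (moveHeight_nonneg w hw.1.1 j)]
  rw [h1, h, BuildingSequence.perm]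
  push_cast
  congr 1
  refine Finset.prod_congr rfl fun i _ => ?_
  rw [pow_mul, sq]

theorem h_le {b : BuildingSequence} (ha : IsBuiltFrom w a) (hb : IsBuiltFrom w b) :
    a.h ≤ b.h := by
  by_contra hc
  have h1 := a.p_pos a.h (by omega) le_rfl
  rw [← (ha.2 a.h).2.1, (hb.2 a.h).2.1, b.p_eq_zero _ (not_le.1 hc)] at h1
  exact lt_irrefl _ h1

theorem unique {b : BuildingSequence} (ha : IsBuiltFrom w a) (hb : IsBuiltFrom w b) : a = b :=
  BuildingSequence.ext (le_antisymm (ha.h_le hb) (hb.h_le ha))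
    (funext fun i => (ha.2 i).1.symm.trans (hb.2 i).1)
    (funext fun i => (ha.2 i).2.1.symm.trans (hb.2 i).2.1)

end IsBuiltFrom

/-- The building sequence that counts the moves of a Motzkin path by their heights. -/
def pathSequence {n : ℕ} (w : Fin n → Move) (hw : IsMotzkin w) : BuildingSequence where
  h := Finset.univ.sup fun j => (moveHeight w j).toNat
  f := moveCount w Move.H
  p := moveCount w Move.U
  p_pos i h1 h2 := by
    obtain ⟨j, -, hj⟩ := (Finset.le_sup_iff (show ⊥ < i from h1)).1 h2
    exact moveCount_U_pos w h1 j (by omega)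
  p_zero := (moveCount_UD_zero w hw.1).1
  p_eq_zero i hi := by
    refine Finset.card_eq_zero.2 (Finset.filter_eq_empty_iff.2 ?_)
    rintro j hj ⟨-, h⟩
    have := Finset.le_sup (f := fun j => (moveHeight w j).toNat) hj
    simp only [h, Int.toNat_natCast] at this
    omega
  f_eq_zero i hi := by
    refine Finset.card_eq_zero.2 (Finset.filter_eq_empty_iff.2 ?_)
    rintro j hj ⟨-, h⟩
    have := Finset.le_sup (f := fun j => (moveHeight w j).toNat) hj
    simp only [h, Int.toNat_natCast] at this
    omega

theorem moveCount_D_eq_U {n : ℕ} (w : Fin n → Move) (hw : IsMotzkin w) (i : ℕ) :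
    moveCount w Move.D i = moveCount w Move.U i := by
  rcases Nat.eq_zero_or_pos i with rfl | hi
  · rw [(moveCount_UD_zero w hw.1).1, (moveCount_UD_zero w hw.1).2]
  · rw [moveCount_U_eq w hw.1 i hi, hw.2, if_neg (by omega), add_zero]

theorem isBuiltFrom_pathSequence {n : ℕ} (w : Fin n → Move) (hw : IsMotzkin w) :
    IsBuiltFrom w (pathSequence w hw) :=
  ⟨hw, fun i => ⟨rfl, rfl, moveCount_D_eq_U w hw i⟩⟩

theorem isBuiltFrom_iff {n : ℕ} {w : Fin n → Move} {a : BuildingSequence} :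
    IsBuiltFrom w a ↔ w ∈ pathsWithCounts n 0 a.f a.p := by
  classical
  unfold pathsWithCounts
  rw [Finset.mem_filter_univ]
  constructor
  · intro h
    exact ⟨h.1.1, h.1.2, fun i => ⟨(h.2 i).1, (h.2 i).2.2⟩⟩
  · rintro ⟨h1, h2, h3⟩
    refine ⟨⟨h1, h2⟩, fun i => ⟨(h3 i).1, ?_, (h3 i).2⟩⟩
    exact (moveCount_D_eq_U w ⟨h1, h2⟩ i).symm.trans (h3 i).2

namespace BuildingSequence

theorem m_eq_prod_levelFactor (a : BuildingSequence) :
    a.m = ∏ i ∈ Finset.range (a.h + 1), levelFactor 0 a.f a.p i := by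
  unfold levelFactor m
  rw [Finset.prod_mul_distrib, Finset.prod_mul_distrib]
  congr 1
  · rw [← prod_Icc_eq_prod_range _ _ (by simp [pieceCount])]
    refine Finset.prod_congr rfl fun i hi => ?_
    obtain ⟨h1, h2⟩ := Finset.mem_Icc.1 hi
    have hp := a.p_pos i h1 h2
    rw [pieceCount, if_neg (by omega), if_neg (by omega), add_zero, Nat.multichoose_eq,
      show a.p i + (a.p (i + 1) + a.f i) - 1 = a.p (i + 1) + a.f i + a.p i - 1 by omega]
    exact Nat.choose_symm_of_eq_add (by omega)
  · rw [Finset.prod_range_succ, a.p_eq_zero (a.h + 1) (Nat.lt_succ_self _), zero_add,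
      Nat.choose_self, mul_one]
    symm
    refine Finset.prod_nbij (fun i => i + 1) ?_ ?_ ?_ ?_
    · intro i hi
      rw [Finset.mem_range] at hi
      exact Finset.mem_Icc.2 ⟨by omega, by omega⟩
    · exact fun i _ j _ h => Nat.succ_injective h
    · intro i hi
      rw [Finset.mem_coe, Finset.mem_Icc] at hi
      exact ⟨i - 1, by simp; omega, by simp; omega⟩
    · intro i _
      rfl

theorem card_pathsWithCounts_eq_m (a : BuildingSequence) :
    (pathsWithCounts a.width 0 a.f a.p).card = a.m := by
  rw [m_eq_prod_levelFactor]
  refine card_pathsWithCounts (a.h + 1) _ 0 _ _ (by omega) (fun i hi => a.f_eq_zero i hi)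
    (fun i hi => a.p_eq_zero i hi) a.p_zero ?_
  rw [width, sum_Icc_eq_sum_range _ _ a.p_zero, add_zero]

theorem P_pos (a : BuildingSequence) : 0 < a.P := by
  refine Nat.mul_pos (Finset.prod_pos fun i hi => ?_) (Nat.mul_pos ?_ ?_)
  · exact Nat.mul_pos (Nat.choose_pos (by omega)) (Nat.choose_pos (by omega))
  · exact Finset.prod_pos fun i _ => by positivity
  · exact Finset.prod_pos fun i hi => Nat.pow_pos (Finset.mem_Icc.1 hi).1

end BuildingSequence

theorem card_perms_isBuiltFrom {n : ℕ} {a : BuildingSequence} (ha : a.width = n)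
    [DecidablePred fun π : Equiv.Perm (Fin n) => IsBuiltFrom (permPath π) a] :
    (Finset.univ.filter fun π : Equiv.Perm (Fin n) => IsBuiltFrom (permPath π) a).card = a.P := by
  subst ha
  have h : ((Finset.univ.filter fun π : Equiv.Perm (Fin a.width) =>
      IsBuiltFrom (permPath π) a).card : ℤ) = a.P := by
    rw [Finset.card_eq_sum_card_fiberwise (f := permPath) (t := pathsWithCounts a.width 0 a.f a.p)]
    · push_cast
      have h1 : ∀ w ∈ pathsWithCounts a.width 0 a.f a.p,
          (((Finset.univ.filter fun π : Equiv.Perm (Fin a.width) =>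
            IsBuiltFrom (permPath π) a).filter fun π => permPath π = w).card : ℤ) = a.perm := by
        intro w hw
        rw [← isBuiltFrom_iff] at hw
        rw [← hw.pathWeight_eq, ← card_permPath_eq_pathWeight w hw.1, Finset.filter_filter]
        congr 2
        refine Finset.filter_congr fun π _ => ⟨fun h => h.2, fun h => ⟨h ▸ hw, h⟩⟩
      rw [Finset.sum_congr rfl h1, Finset.sum_const, a.card_pathsWithCounts_eq_m, nsmul_eq_mul,
        BuildingSequence.P]
      push_cast
      ring
    · intro π hπ
      rw [Finset.mem_coe, Finset.mem_filter_univ] at hπ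
      exact isBuiltFrom_iff.1 hπ
  exact_mod_cast h

/-- The building sequence of the path of a permutation. -/
def permSequence {n : ℕ} (π : Equiv.Perm (Fin n)) : BuildingSequence :=
  pathSequence (permPath π) (isMotzkin_permPath π)

theorem isBuiltFrom_permSequence {n : ℕ} (π : Equiv.Perm (Fin n)) :
    IsBuiltFrom (permPath π) (permSequence π) :=
  isBuiltFrom_pathSequence _ _

theorem permSequence_eq_iff {n : ℕ} {π : Equiv.Perm (Fin n)} {a : BuildingSequence} :
    permSequence π = a ↔ IsBuiltFrom (permPath π) a :=
  ⟨fun h => h ▸ isBuiltFrom_permSequence π, fun h => (isBuiltFrom_permSequence π).unique h⟩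

theorem totalDisplacement_eq_area {n : ℕ} (π : Equiv.Perm (Fin n)) :
    totalDisplacement π = 2 * (permSequence π).area := by
  have h := totalDisplacement_eq π
  rw [(isBuiltFrom_permSequence π).pathArea_eq] at h
  exact_mod_cast h

open Classical in
theorem card_perms_permSequence_eq {n : ℕ} {a : BuildingSequence} (ha : a.width = n) :
    (Finset.univ.filter fun π : Equiv.Perm (Fin n) => permSequence π = a).card = a.P := by
  simp only [permSequence_eq_iff]
  exact card_perms_isBuiltFrom ha

theorem displacementNumber_eq_sum_pathWeight (n A : ℕ) :
    (displacementNumber n A : ℤ) = ∑ w ∈ motzkinPaths n A, pathWeight w := by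
  classical
  have harea : ∀ π : Equiv.Perm (Fin n),
      totalDisplacement π = 2 * A ↔ pathArea (permPath π) = (A : ℚ) := by
    intro π
    have h := totalDisplacement_eq π
    constructor
    · intro h'
      rw [h'] at h
      push_cast at h
      linarith
    · intro h'
      rw [h'] at h
      exact_mod_cast h
  unfold displacementNumber
  rw [Finset.card_eq_sum_card_fiberwise (f := permPath) (t := motzkinPaths n A)]
  · push_cast
    refine Finset.sum_congr rfl fun w hw => ?_
    unfold motzkinPaths at hw
    rw [Finset.mem_filter_univ] at hw
    rw [← card_permPath_eq_pathWeight w hw.1, Finset.filter_filter]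
    congr 2
    refine Finset.filter_congr fun π _ => ⟨fun h => h.2, fun h => ⟨?_, h⟩⟩
    rw [harea, h, hw.2]
  · intro π hπ
    rw [Finset.mem_coe, Finset.mem_filter_univ] at hπ
    unfold motzkinPaths
    rw [Finset.mem_coe, Finset.mem_filter_univ]
    exact ⟨isMotzkin_permPath π, (harea π).1 hπ⟩

theorem displacementNumber_eq_sum_P (n A : ℕ) :
    displacementNumber n A = ∑ a ∈ buildingSequences n A, a.P := by
  classical
  unfold displacementNumber
  rw [Finset.card_eq_sum_card_fiberwise (f := permSequence) (t := buildingSequences n A)]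
  · refine Finset.sum_congr rfl fun a ha => ?_
    rw [mem_buildingSequences] at ha
    rw [← card_perms_permSequence_eq ha.1, Finset.filter_filter]
    congr 1
    refine Finset.filter_congr fun π _ => ⟨fun h => h.2, fun h => ⟨?_, h⟩⟩
    rw [totalDisplacement_eq_area, h, ha.2]
  · intro π hπ
    rw [Finset.mem_coe, Finset.mem_filter_univ, totalDisplacement_eq_area] at hπ
    rw [Finset.mem_coe, mem_buildingSequences]
    exact ⟨(isBuiltFrom_permSequence π).width_eq, by omega⟩

theorem corollary2 (n : ℕ) :
    (∃ φ : Equiv.Perm (Fin n) → {a : BuildingSequence // a.width = n},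
      (∀ π, IsBuiltFrom (permPath π) (φ π).1) ∧
      Function.Surjective φ ∧
      ∀ A : ℕ, ∀ a ∈ buildingSequences n A,
        Nat.card {π : Equiv.Perm (Fin n) // totalDisplacement π = 2 * A ∧ (φ π).1 = a} =
          a.P) ∧
    ∀ A : ℕ,
      (displacementNumber n A : ℤ) = ∑ w ∈ motzkinPaths n A, pathWeight w ∧
      displacementNumber n A = ∑ a ∈ buildingSequences n A, a.P := by
  classical
  refine ⟨⟨fun π => ⟨permSequence π, (isBuiltFrom_permSequence π).width_eq⟩,
    isBuiltFrom_permSequence, ?_, ?_⟩, fun A =>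
    ⟨displacementNumber_eq_sum_pathWeight n A, displacementNumber_eq_sum_P n A⟩⟩
  · rintro ⟨a, ha⟩
    have h := a.P_pos
    rw [← card_perms_permSequence_eq ha, Finset.card_pos] at h
    obtain ⟨π, hπ⟩ := h
    exact ⟨π, Subtype.ext (Finset.mem_filter.1 hπ).2⟩
  · intro A a ha
    rw [mem_buildingSequences] at ha
    rw [← card_perms_permSequence_eq ha.1, Nat.card_eq_fintype_card, Fintype.card_subtype]
    congr 1
    refine Finset.filter_congr fun π _ => ⟨fun h => h.2, fun h => ⟨?_, h⟩⟩
    rw [totalDisplacement_eq_area, h, ha.2]
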